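/- For $c,d\in\mathbb N^2$ (where $0\in\mathbb N$) write $c\preceq d$ if $c=d$ or if, for each $i\in\{1,2\}$, either $c_i=d_i=0$ or $c_i<d_i$. For $a,b\in\mathbb N$ let $P(a,b)=\{c\in\mathbb N^2: c\preceq(a,b)\}$, partially ordered by $\preceq$; it has least element $(0,0)$ and greatest element $(a,b)$. Let $\Delta(P(a,b))$ be its order complex, i.e. the simplicial complex of all finite chains in $P(a,b)\setminus\{(0,0),(a,b)\}$, and let $$\widetilde\chi(\Delta(P(a,b)))=\sum_{i\ge -1}(-1)^i\,\mathrm{rank}\,\widetilde H_i(\Delta(P(a,b));\mathbb Z)$$ be its reduced Euler characteristic, where $\widetilde H_i$ denotes reduced simplicial homology. **Theorem 1.5.** For all integers $2\le a\le b$, $$\widetilde\chi(\Delta(P(a,b)))=(-1)^a\cdot 2\sum_{h=0}^{\lfloor a/2\rfloor-1}(-1)^h\binom{a-2}{h}\binom{b-a}{a-2-2h}.$$ Moreover, for all $2\le a\le b$, $\widetilde\chi(\Delta(P(a,b)))$ is the coefficient of $u^av^b$ in the expansion of $$\frac{2u^2v^2}{2uv-u-v+1}$$ as a formal power series in $u,v$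 over $\mathbb Q$. -/

import Mathlib

/-! ### Proper divisibility -/

/-- The exponent vector `c` properly divides the exponent vector `d`: in every coordinate either
both exponents are zero or the exponent of `c` is strictly smaller. -/
def ProperlyDivides {n : ℕ} (c d : Fin n → ℕ) : Prop :=
  ∀ i, (c i = 0 ∧ d i = 0) ∨ c i < d i

/-- The order relation of proper division: equality or proper divisibility. -/
def ProperDivLE {n : ℕ} (c d : Fin n → ℕ) : Prop :=
  c = d ∨ ProperlyDivides c d

/-- The poset `P(a₁, …, aₙ)` of all exponent vectors below `(a₁, …, aₙ)` in the order of proper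
division. -/
@[ext]
structure ProperDivPoset {n : ℕ} (a : Fin n → ℕ) where
  /-- the exponent vector -/
  val : Fin n → ℕ
  le_top' : ProperDivLE val a

namespace ProperDivPoset

instance {n : ℕ} (a : Fin n → ℕ) : PartialOrder (ProperDivPoset a) where
  le p q := ProperDivLE p.val q.val
  le_refl p := Or.inl rfl
  le_trans p q r hpq hqr := by
    rcases hpq with h | h
    · rw [h]; exact hqr
    · rcases hqr with h' | h'
      · rw [← h']; exact Or.inr h
      · refine Or.inr fun i => ?_
        have h1 := h i
        have h2 := h' i
        omega
  le_antisymm p q hpq hqp := by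
    rcases hpq with h | h
    · exact ProperDivPoset.ext h
    · rcases hqp with h' | h'
      · exact ProperDivPoset.ext h'.symm
      · refine ProperDivPoset.ext (funext fun i => ?_)
        have h1 := h i
        have h2 := h' i
        omega

/-- The least element is `(0, …, 0)` and the greatest element is `(a₁, …, aₙ)`. -/
instance {n : ℕ} (a : Fin n → ℕ) : BoundedOrder (ProperDivPoset a) where
  top := ⟨a, Or.inl rfl⟩
  le_top p := p.le_top'
  bot := ⟨fun _ => 0, Or.inr fun i => by
    show ((0 : ℕ) = 0 ∧ a i = 0) ∨ 0 < a i
    omega⟩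
  bot_le p := Or.inr fun i => by
    show ((0 : ℕ) = 0 ∧ p.val i = 0) ∨ 0 < p.val i
    omega

end ProperDivPoset

/-! ### The order complex -/

/-- The order complex `Δ(P)` of a bounded poset `P`: its faces are the nonempty finite chains of
`P` that contain neither the least element nor the greatest element. -/
def orderComplex (P : Type*) [PartialOrder P] [BoundedOrder P] :
    PreAbstractSimplicialComplex P where
  faces := {s | s.Nonempty ∧ IsChain (· ≤ ·) (s : Set P) ∧ ⊥ ∉ s ∧ ⊤ ∉ s}
  isRelLowerSet_faces := by
    rintro s ⟨hs, hc, hb, ht⟩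
    exact ⟨hs, fun t hts htn => ⟨htn, hc.mono (Finset.coe_subset.2 hts),
      fun h => hb (hts h), fun h => ht (hts h)⟩⟩

/-! ### Reduced simplicial homology

Simplicial chains of a complex whose vertices carry a partial order that is total on every face
(for instance a linear order of the vertices or, for an order complex, the order of the poset).
Every face is oriented by listing its vertices increasingly.  Chain groups and homology groups are
indexed by the number `k` of vertices, so that `k` stands for dimension `k - 1`, and `k = 0` is the
empty simplex of the augmentation. -/

namespace PreAbstractSimplicialComplex

variable {V : Type*} [PartialOrder V]

/-- The oriented simplices `v₀ < ⋯ < v_{k-1}` with `k` vertices; for `k = 0` there is exactly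
one, the empty simplex. -/
def OrderedSimplex (K : PreAbstractSimplicialComplex V) (k : ℕ) : Type _ :=
  {σ : Fin k ↪o V // k = 0 ∨ Finset.univ.map σ.toEmbedding ∈ K.faces}

/-- The `i`-th facet of an oriented simplex, obtained by deleting its `i`-th vertex. -/
def OrderedSimplex.facet {K : PreAbstractSimplicialComplex V} {k : ℕ}
    (σ : K.OrderedSimplex (k + 1)) (i : Fin (k + 1)) : K.OrderedSimplex k :=
  ⟨(Fin.succAboveOrderEmb i).trans σ.1, by
    rcases Nat.eq_zero_or_pos k with hk | hk
    · exact Or.inl hk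
    · refine Or.inr ((K.isRelLowerSet_faces (σ.2.resolve_left (Nat.succ_ne_zero k))).2 ?_ ?_)
      · intro v hv
        obtain ⟨j, -, rfl⟩ := Finset.mem_map.1 hv
        exact Finset.mem_map.2 ⟨i.succAbove j, Finset.mem_univ _, rfl⟩
      · exact ⟨_, Finset.mem_map.2 ⟨⟨0, hk⟩, Finset.mem_univ _, rfl⟩⟩⟩

/-- The group of simplicial chains with integer coefficients in dimension `k - 1`. -/
abbrev Chains (K : PreAbstractSimplicialComplex V) (k : ℕ) : Type _ :=
  K.OrderedSimplex k →₀ ℤ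

/-- The boundary map `∂ [v₀, …, v_k] = ∑ i, (-1) ^ i [v₀, …, v̂ᵢ, …, v_k]`; for `k = 0` it is the
augmentation. -/
noncomputable def boundary (K : PreAbstractSimplicialComplex V) (k : ℕ) :
    K.Chains (k + 1) →ₗ[ℤ] K.Chains k :=
  Finsupp.linearCombination ℤ fun σ : K.OrderedSimplex (k + 1) =>
    ∑ i : Fin (k + 1), Finsupp.single (σ.facet i) ((-1 : ℤ) ^ (i : ℕ))

/-- The reduced cycles in dimension `k - 1`. -/
noncomputable def reducedCycles (K : PreAbstractSimplicialComplex V) :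
    (k : ℕ) → Submodule ℤ (K.Chains k)
  | 0 => ⊤
  | k + 1 => LinearMap.ker (K.boundary k)

/-- The boundaries in dimension `k - 1`. -/
noncomputable def boundaries (K : PreAbstractSimplicialComplex V) (k : ℕ) :
    Submodule ℤ (K.Chains k) :=
  LinearMap.range (K.boundary k)

lemma OrderedSimplex.facet_facet {K : PreAbstractSimplicialComplex V} {k : ℕ}
    (σ : K.OrderedSimplex (k + 2)) (i : Fin (k + 2)) (j : Fin (k + 1)) :
    (σ.facet i).facet j = (σ.facet (i.succAbove j)).facet (j.predAbove i) := by
  apply Subtype.ext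
  apply RelEmbedding.ext
  intro l
  show σ.1 (i.succAbove (j.succAbove l)) =
    σ.1 ((i.succAbove j).succAbove ((j.predAbove i).succAbove l))
  rw [Fin.succAbove_succAbove_succAbove_predAbove]

/-- The boundary of a boundary is zero. -/
lemma boundaries_le_reducedCycles (K : PreAbstractSimplicialComplex V) (k : ℕ) :
    K.boundaries k ≤ K.reducedCycles k := by
  cases k with
  | zero => exact le_top
  | succ k =>
    rintro _ ⟨x, rfl⟩
    show K.boundary k (K.boundary (k + 1) x) = 0
    suffices h : (K.boundary k).comp (K.boundary (k + 1)) = 0 from LinearMap.congr_fun h x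
    apply Finsupp.lhom_ext'
    intro σ
    apply LinearMap.ext_ring
    simp only [LinearMap.comp_apply, Finsupp.lsingle_apply, boundary, LinearMap.zero_apply,
      Finsupp.linearCombination_single, one_smul, map_sum, Finset.smul_sum, Finsupp.smul_single,
      smul_eq_mul, ← pow_add]
    rw [← Finset.sum_product']
    refine Finset.sum_involution (fun p _ => (p.1.succAbove p.2, p.2.predAbove p.1))
      ?_ ?_ (fun _ _ => Finset.mem_univ _) ?_
    · rintro ⟨i, j⟩ -
      simp only
      rw [OrderedSimplex.facet_facet σ i j, ← Finsupp.single_add, ← Finsupp.single_zero]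
      congr 1
      have h := Fin.neg_one_pow_succAbove_add_predAbove (R := ℤ) i j
      lia
    · rintro ⟨i, j⟩ - - h
      exact Fin.succAbove_ne i j (Prod.ext_iff.1 h).1
    · rintro ⟨i, j⟩ -
      simp only [Fin.succAbove_succAbove_predAbove, Fin.predAbove_predAbove_succAbove]

/-- The reduced simplicial homology group `H̃_{k-1}(K; ℤ)`, cycles modulo boundaries. -/
abbrev ReducedHomology (K : PreAbstractSimplicialComplex V) (k : ℕ) : Type _ :=
  K.reducedCycles k ⧸ (K.boundaries k).submoduleOf (K.reducedCycles k)

/-- The reduced Euler characteristic `∑_{i ≥ -1} (-1) ^ i rank H̃_i(K; ℤ)`, where `i = k - 1`. -/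
noncomputable def reducedEulerChar (K : PreAbstractSimplicialComplex V) : ℤ :=
  ∑ᶠ k : ℕ, (-1 : ℤ) ^ (k + 1) * (Module.finrank ℤ (K.ReducedHomology k) : ℤ)

end PreAbstractSimplicialComplex

/-! ### The Euler–Poincaré formula -/

namespace PreAbstractSimplicialComplex

variable {V : Type*} [PartialOrder V]

/-! By Euler–Poincaré the characteristic is an alternating count of chains
(`reducedEulerChar_eq_sum`). Sorting chains by their greatest element gives the recursion of the
Möbius function `μ` (`chainEulerChar_eq`). The elements strictly below `(i, j) ≠ (0, 0)` form a box,
so box sums of `μ` equal `-μ(i, j)`. Differencing them in both directions gives `μ(i+1, j+1) = μ(i,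
j+1) + μ(i+1, j) - 2μ(i, j)` for `i, j ≥ 1`. The solution is twice the coefficient of `x^m` in
`(1-x)^n (1+x)^m`, at `m = i-1`, `n = j-1` for `μ(i+1, j+1)`. For `n = m + r` this product is
`(1-x²)^m (1-x)^r`, whence the binomial sum. The same recursion says that these coefficients have
generating function `1/(2uv-u-v+1)`. -/

lemma finrank_chains (K : PreAbstractSimplicialComplex V) (k : ℕ) :
    Module.finrank ℤ (K.Chains k) = Nat.card (K.OrderedSimplex k) := by
  rw [Module.finrank_eq_nat_card_basis Finsupp.basisSingleOne]

variable [Finite V]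

instance (K : PreAbstractSimplicialComplex V) (k : ℕ) : Finite (K.OrderedSimplex k) :=
  Finite.of_injective (fun σ i => σ.1 i : K.OrderedSimplex k → Fin k → V) fun _ _ h =>
    Subtype.ext (RelEmbedding.ext fun i => congrFun h i)

lemma finrank_reducedHomology_add (K : PreAbstractSimplicialComplex V) (k : ℕ) :
    Module.finrank ℤ (K.ReducedHomology k) + Module.finrank ℤ (K.boundaries k) =
      Module.finrank ℤ (K.reducedCycles k) := by
  rw [← (Submodule.submoduleOfEquivOfLe (K.boundaries_le_reducedCycles k)).finrank_eq]
  exact Submodule.finrank_quotient_add_finrank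
    ((K.boundaries k).submoduleOf (K.reducedCycles k))

lemma finrank_boundaries_add (K : PreAbstractSimplicialComplex V) (k : ℕ) :
    Module.finrank ℤ (K.boundaries k) + Module.finrank ℤ (K.reducedCycles (k + 1)) =
      Nat.card (K.OrderedSimplex (k + 1)) := by
  rw [← finrank_chains, boundaries, ← (K.boundary k).quotKerEquivRange.finrank_eq]
  exact Submodule.finrank_quotient_add_finrank (LinearMap.ker (K.boundary k))

/-- Rank–nullity makes the boundary ranks telescope; only the last one survives. -/
lemma sum_range_finrank_reducedHomology (K : PreAbstractSimplicialComplex V) (n : ℕ) :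
    ∑ k ∈ Finset.range (n + 1),
        (-1 : ℤ) ^ (k + 1) * (Module.finrank ℤ (K.ReducedHomology k) : ℤ) =
      ∑ k ∈ Finset.range (n + 1), (-1 : ℤ) ^ (k + 1) * (Nat.card (K.OrderedSimplex k) : ℤ) +
        (-1) ^ n * (Module.finrank ℤ (K.boundaries n) : ℤ) := by
  induction n with
  | zero =>
    have h := K.finrank_reducedHomology_add 0
    have h' : Module.finrank ℤ (K.reducedCycles 0) = Nat.card (K.OrderedSimplex 0) := by
      rw [← finrank_chains]
      exact finrank_top ℤ (K.Chains 0)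
    simp
    lia
  | succ n ih =>
    rw [Finset.sum_range_succ, ih, Finset.sum_range_succ _ (n + 1)]
    have h : (Module.finrank ℤ (K.ReducedHomology (n + 1)) : ℤ) =
        Nat.card (K.OrderedSimplex (n + 1)) - Module.finrank ℤ (K.boundaries n) -
          Module.finrank ℤ (K.boundaries (n + 1)) := by
      have h1 := K.finrank_reducedHomology_add (n + 1)
      have h2 := K.finrank_boundaries_add n
      lia
    rw [h]
    ring

lemma isEmpty_orderedSimplex (K : PreAbstractSimplicialComplex V) {k : ℕ} (hk : Nat.card V < k) :
    IsEmpty (K.OrderedSimplex k) := by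
  refine ⟨fun σ => ?_⟩
  have h := Nat.card_le_card_of_injective σ.1 σ.1.injective
  rw [Nat.card_fin] at h
  omega

/-- The Euler–Poincaré formula. -/
lemma reducedEulerChar_eq_sum (K : PreAbstractSimplicialComplex V) :
    K.reducedEulerChar = ∑ k ∈ Finset.range (Nat.card V + 1),
      (-1 : ℤ) ^ (k + 1) * (Nat.card (K.OrderedSimplex k) : ℤ) := by
  have hc : ∀ k, Nat.card V < k → Nat.card (K.OrderedSimplex k) = 0 := fun k hk => by
    have := K.isEmpty_orderedSimplex hk
    exact Nat.card_of_isEmpty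
  have hb : Module.finrank ℤ (K.boundaries (Nat.card V)) = 0 := by
    have h := K.finrank_boundaries_add (Nat.card V)
    rw [hc _ (Nat.lt_succ_self _)] at h
    omega
  have h := K.sum_range_finrank_reducedHomology (Nat.card V)
  rw [hb, Nat.cast_zero, mul_zero, add_zero] at h
  rw [← h, reducedEulerChar]
  -- `∑ᶠ` defaults to `0` on infinite support, so the homology ranks beyond `Nat.card V` must be
  -- shown to vanish.
  refine finsum_eq_sum_of_support_subset _ fun k hk => ?_
  by_contra hk'
  have hlt : Nat.card V < k := by simpa using hk'
  obtain ⟨m, rfl⟩ : ∃ m, k = m + 1 := ⟨k - 1, by omega⟩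
  have h1 := K.finrank_reducedHomology_add (m + 1)
  have h2 := K.finrank_boundaries_add m
  rw [hc _ hlt] at h2
  have h3 : Module.finrank ℤ (K.ReducedHomology (m + 1)) = 0 := by omega
  exact hk (by simp only [h3, Nat.cast_zero, mul_zero])

end PreAbstractSimplicialComplex

/-! ### Counting chains by their greatest element -/

section ChainCount

variable {P : Type*} [PartialOrder P] [BoundedOrder P]

/-- The chains with `k` elements in the open interval from `⊥` to `x`. -/
def ChainBelow (x : P) (k : ℕ) : Type _ :=
  {σ : Fin k → P // StrictMono σ ∧ ∀ i, ⊥ < σ i ∧ σ i < x}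

instance [Finite P] (x : P) (k : ℕ) : Finite (ChainBelow x k) :=
  inferInstanceAs (Finite {σ : Fin k → P // StrictMono σ ∧ ∀ i, ⊥ < σ i ∧ σ i < x})

lemma ChainBelow.sigma_ext {x : P} {k : ℕ}
    {p q : Σ y : {y : P // ⊥ < y ∧ y < x}, ChainBelow y.1 k}
    (h₁ : p.1.1 = q.1.1) (h₂ : p.2.1 = q.2.1) : p = q := by
  obtain ⟨⟨y, hy⟩, σ, hσ⟩ := p
  obtain ⟨⟨z, hz⟩, τ, hτ⟩ := q
  obtain rfl : y = z := h₁
  obtain rfl : σ = τ := h₂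
  rfl

/-- A chain is determined by its greatest element and the remaining chain. -/
def ChainBelow.succEquiv (x : P) (k : ℕ) :
    ChainBelow x (k + 1) ≃ Σ y : {y : P // ⊥ < y ∧ y < x}, ChainBelow y.1 k where
  toFun σ := ⟨⟨σ.1 (Fin.last k), σ.2.2 _⟩, fun i => σ.1 i.castSucc,
    σ.2.1.comp Fin.strictMono_castSucc,
    fun i => ⟨(σ.2.2 _).1, σ.2.1 (Fin.castSucc_lt_last i)⟩⟩
  invFun p := ⟨Fin.snoc (α := fun _ => P) p.2.1 p.1.1, by
    constructor
    · intro i j hij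
      induction j using Fin.lastCases with
      | last =>
        induction i using Fin.lastCases with
        | last => exact absurd hij (lt_irrefl _)
        | cast i => simpa using (p.2.2.2 i).2
      | cast j =>
        induction i using Fin.lastCases with
        | last => exact absurd hij (not_lt.2 (Fin.le_last _))
        | cast i => simpa using p.2.2.1 (Fin.castSucc_lt_castSucc_iff.1 hij)
    · intro i
      induction i using Fin.lastCases with
      | last => simpa using p.1.2
      | cast i => simpa using ⟨(p.2.2.2 i).1, (p.2.2.2 i).2.trans p.1.2.2⟩⟩
  left_inv σ := by
    apply Subtype.ext
    funext i
    induction i using Fin.lastCases <;> simp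
  right_inv p := by
    exact ChainBelow.sigma_ext (by simp) (by simp)

/-- The simplices of the order complex are the chains of the proper part. -/
def orderedSimplexEquiv (k : ℕ) :
    (orderComplex P).OrderedSimplex k ≃ ChainBelow (⊤ : P) k where
  toFun σ := ⟨σ.1, σ.1.strictMono, fun i => by
    rcases σ.2 with h | ⟨-, -, hb, ht⟩
    · exact absurd i.2 (by omega)
    · have hi : σ.1 i ∈ Finset.univ.map σ.1.toEmbedding :=
        Finset.mem_map.2 ⟨i, Finset.mem_univ _, rfl⟩
      exact ⟨bot_lt_iff_ne_bot.2 fun h => hb (h ▸ hi), lt_top_iff_ne_top.2 fun h => ht (h ▸ hi)⟩⟩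
  invFun τ := ⟨OrderEmbedding.ofStrictMono τ.1 τ.2.1, by
    rcases Nat.eq_zero_or_pos k with hk | hk
    · exact Or.inl hk
    · refine Or.inr ⟨⟨_, Finset.mem_map.2 ⟨⟨0, hk⟩, Finset.mem_univ _, rfl⟩⟩, ?_, ?_, ?_⟩
      · intro x hx y hy _
        obtain ⟨i, -, rfl⟩ := Finset.mem_map.1 hx
        obtain ⟨j, -, rfl⟩ := Finset.mem_map.1 hy
        exact (le_total i j).imp (fun h => τ.2.1.monotone h) (fun h => τ.2.1.monotone h)
      · intro h
        obtain ⟨i, -, hi⟩ := Finset.mem_map.1 h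
        exact (τ.2.2 i).1.ne' hi
      · intro h
        obtain ⟨i, -, hi⟩ := Finset.mem_map.1 h
        exact (τ.2.2 i).2.ne hi⟩
  left_inv _ := rfl
  right_inv _ := rfl

lemma card_chainBelow_zero (x : P) : Nat.card (ChainBelow x 0) = 1 := by
  rw [Nat.card_eq_one_iff_unique]
  exact ⟨⟨fun _ _ => Subtype.ext (funext fun i => i.elim0)⟩,
    ⟨⟨Fin.elim0, fun i => i.elim0, fun i => i.elim0⟩⟩⟩

variable [Finite P]

/-- The reduced Euler characteristic of the order complex of the open interval `(⊥, x)`. -/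
noncomputable def chainEulerChar (x : P) : ℤ :=
  ∑ k ∈ Finset.range (Nat.card P + 1), (-1 : ℤ) ^ (k + 1) * (Nat.card (ChainBelow x k) : ℤ)

lemma reducedEulerChar_orderComplex :
    (orderComplex P).reducedEulerChar = chainEulerChar (⊤ : P) := by
  rw [PreAbstractSimplicialComplex.reducedEulerChar_eq_sum, chainEulerChar]
  simp only [Nat.card_congr (orderedSimplexEquiv _)]

lemma card_chainBelow_eq_zero (x : P) {k : ℕ} (hk : Nat.card P < k) :
    Nat.card (ChainBelow x k) = 0 := by
  have : IsEmpty (ChainBelow x k) := ⟨fun σ => by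
    have h := Nat.card_le_card_of_injective σ.1 σ.2.1.injective
    rw [Nat.card_fin] at h
    omega⟩
  exact Nat.card_of_isEmpty

open Classical in
-- The `-1` is the empty chain; removing the greatest element `y` of any other chain flips its sign.
lemma chainEulerChar_eq [Fintype P] (x : P) :
    chainEulerChar x = -1 - ∑ y : P with ⊥ < y ∧ y < x, chainEulerChar y := by
  -- An extra zero term makes the ranges agree after the index shift.
  have h : chainEulerChar x = ∑ k ∈ Finset.range (Nat.card P + 1 + 1),
      (-1 : ℤ) ^ (k + 1) * (Nat.card (ChainBelow x k) : ℤ) := by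
    rw [Finset.sum_range_succ, card_chainBelow_eq_zero x (Nat.lt_succ_self _), Nat.cast_zero,
      mul_zero, add_zero, chainEulerChar]
  have hs : ∀ k, (Nat.card (ChainBelow x (k + 1)) : ℤ) =
      ∑ y : P with ⊥ < y ∧ y < x, (Nat.card (ChainBelow y k) : ℤ) := fun k => by
    rw [Nat.card_congr (ChainBelow.succEquiv x k), Nat.card_sigma, Nat.cast_sum]
    exact (Finset.sum_subtype (p := fun y : P => ⊥ < y ∧ y < x) _ (fun y => by simp)
      fun y => (Nat.card (ChainBelow y k) : ℤ)).symm
  have hc : ∑ y : P with ⊥ < y ∧ y < x, chainEulerChar y =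
      -∑ k ∈ Finset.range (Nat.card P + 1),
        (-1 : ℤ) ^ (k + 1 + 1) * (Nat.card (ChainBelow x (k + 1)) : ℤ) := by
    simp only [chainEulerChar]
    rw [Finset.sum_comm, ← Finset.sum_neg_distrib]
    refine Finset.sum_congr rfl fun k _ => ?_
    rw [hs, ← Finset.mul_sum]
    ring
  rw [h, hc, Finset.sum_range_succ', card_chainBelow_zero]
  push_cast
  ring

end ChainCount

/-! ### The coefficients of `(1 - x) ^ n * (1 + x) ^ m` -/

section Coefficients

open Polynomial

/-- The coefficient of `x ^ m` in `(1 - x) ^ n * (1 + x) ^ m`. -/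
noncomputable def diagCoeff (m n : ℕ) : ℤ :=
  ((1 - X : ℤ[X]) ^ n * (1 + X) ^ m).coeff m

lemma diagCoeff_zero_left (n : ℕ) : diagCoeff 0 n = 1 := by
  simp [diagCoeff, coeff_zero_eq_eval_zero]

lemma diagCoeff_zero_right (m : ℕ) : diagCoeff m 0 = 1 := by
  simp [diagCoeff, coeff_one_add_X_pow]

/-- Multiply `(1-x)(1+x) = (1-x)x + (1+x) - 2x` by `(1-x)^n (1+x)^m`. -/
lemma diagCoeff_succ_succ (m n : ℕ) :
    diagCoeff (m + 1) (n + 1) = diagCoeff m (n + 1) + diagCoeff (m + 1) n - 2 * diagCoeff m n := by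
  have h : (1 - X : ℤ[X]) ^ (n + 1) * (1 + X) ^ (m + 1) =
      (1 - X) ^ (n + 1) * (1 + X) ^ m * X + (1 - X) ^ n * (1 + X) ^ (m + 1) -
        C 2 * ((1 - X) ^ n * (1 + X) ^ m * X) := by
    rw [C_ofNat]
    ring
  unfold diagCoeff
  rw [h, coeff_sub, coeff_add, coeff_C_mul, coeff_mul_X, coeff_mul_X]

lemma coeff_one_sub_X_pow (n k : ℕ) :
    ((1 - X : ℤ[X]) ^ n).coeff k = (-1) ^ k * (n.choose k : ℤ) := by
  have h : (1 - X : ℤ[X]) ^ n = ((1 + X) ^ n).comp (C (-1) * X) := by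
    simp [sub_eq_add_neg]
  rw [h, comp_C_mul_X_coeff, coeff_one_add_X_pow, mul_comm]

lemma diagCoeff_add (m r : ℕ) :
    diagCoeff m (m + r) = (-1) ^ m * ∑ h ∈ Finset.range (m / 2 + 1),
      (-1 : ℤ) ^ h * (m.choose h : ℤ) * (r.choose (m - 2 * h) : ℤ) := by
  have h : (1 - X : ℤ[X]) ^ (m + r) * (1 + X) ^ m = expand ℤ 2 ((1 - X) ^ m) * (1 - X) ^ r := by
    simp only [map_pow, map_sub, map_one, expand_X]
    rw [show (1 - X ^ 2 : ℤ[X]) = (1 - X) * (1 + X) by ring, mul_pow]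
    ring
  rw [diagCoeff, h, coeff_mul, Finset.Nat.sum_antidiagonal_eq_sum_range_succ_mk, Finset.mul_sum]
  symm
  refine Finset.sum_of_injOn (fun h => 2 * h) (fun x _ y _ hxy => by simpa using hxy) ?_ ?_ ?_
  · intro x hx
    simp only [Finset.coe_range, Set.mem_Iio] at hx ⊢
    omega
  -- Odd `k` contribute nothing, since `(1-x²)^m` has only even powers.
  · intro k hk hk'
    rw [coeff_expand two_pos, if_neg, zero_mul]
    rintro ⟨c, rfl⟩
    refine hk' ⟨c, ?_, rfl⟩
    simp only [Finset.mem_range, Finset.coe_range, Set.mem_Iio] at hk ⊢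
    omega
  · intro x hx
    have hx' : 2 * x ≤ m := by
      rw [Finset.mem_range] at hx
      omega
    have hsign : (-1 : ℤ) ^ (m - 2 * x) = (-1) ^ m := by
      conv_rhs => rw [← Nat.sub_add_cancel hx', pow_add, pow_mul]
      simp
    rw [coeff_expand two_pos, if_pos (dvd_mul_right 2 x), Nat.mul_div_cancel_left x two_pos,
      coeff_one_sub_X_pow, coeff_one_sub_X_pow, hsign]
    ring

end Coefficients

/-! ### The values of the Möbius function -/

/-- The value `μ((0, 0), (i, j))` of the Möbius function of proper division. -/
noncomputable def properDivMoebius : ℕ → ℕ → ℤ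
  | 0, 0 => 1
  | 0, 1 => -1
  | 0, _ + 2 => 0
  | 1, 0 => -1
  | 1, 1 => -1
  | 1, _ + 2 => 0
  | _ + 2, 0 => 0
  | _ + 2, 1 => 0
  | i + 2, j + 2 => 2 * diagCoeff i j

/-- Indices start at 2 because exponent 0 allows `{0}` below it rather than the empty range; at `(1,
1)` the identity fails. -/
lemma properDivMoebius_succ_succ (i j : ℕ) :
    properDivMoebius (i + 2) (j + 2) = properDivMoebius (i + 1) (j + 2) +
      properDivMoebius (i + 2) (j + 1) - 2 * properDivMoebius (i + 1) (j + 1) := by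
  rcases i with _ | i <;> rcases j with _ | j <;>
    simp only [properDivMoebius, diagCoeff_zero_left, diagCoeff_zero_right, zero_add,
      diagCoeff_succ_succ] <;> ring

lemma sum_range_properDivMoebius (i j : ℕ) :
    ∑ l ∈ Finset.range (j + 1), properDivMoebius (i + 1) l =
      properDivMoebius (i + 1) (j + 1) - properDivMoebius (i + 2) (j + 1) := by
  induction j with
  | zero => rcases i with _ | i <;> simp [properDivMoebius]
  | succ j ih =>
    rw [Finset.sum_range_succ, ih, properDivMoebius_succ_succ]
    ring

lemma sum_range_properDivMoebius_zero (j : ℕ) :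
    ∑ l ∈ Finset.range (j + 1), properDivMoebius 0 l = -properDivMoebius 1 (j + 1) := by
  induction j with
  | zero => simp [properDivMoebius]
  | succ j ih =>
    rw [Finset.sum_range_succ, ih]
    rcases j with _ | j <;> simp [properDivMoebius]

lemma sum_range_properDivMoebius_left_zero (i : ℕ) :
    ∑ l ∈ Finset.range (i + 1), properDivMoebius l 0 = -properDivMoebius (i + 1) 0 := by
  induction i with
  | zero => simp [properDivMoebius]
  | succ i ih =>
    rw [Finset.sum_range_succ, ih]
    simp [properDivMoebius]

/-- The boxes below `(0, j+1)` and `(1, j+1)` are the same row, so the two values agree. -/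
lemma sum_range_properDivMoebius_right_zero (j : ℕ) :
    ∑ l ∈ Finset.range (j + 1), properDivMoebius 0 l = -properDivMoebius 0 (j + 1) := by
  rw [sum_range_properDivMoebius_zero]
  rcases j with _ | j <;> rfl

lemma sum_range_sum_range_properDivMoebius (i j : ℕ) :
    ∑ k ∈ Finset.range (i + 1), ∑ l ∈ Finset.range (j + 1), properDivMoebius k l =
      -properDivMoebius (i + 1) (j + 1) := by
  induction i with
  | zero => simpa using sum_range_properDivMoebius_zero j
  | succ i ih =>
    rw [Finset.sum_range_succ, ih, sum_range_properDivMoebius]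
    ring

/-- The exponents that may occur below the exponent `n` in the order of proper division. -/
def properExponents (n : ℕ) : Finset ℕ :=
  if n = 0 then {0} else Finset.range n

lemma mem_properExponents {m n : ℕ} : m ∈ properExponents n ↔ (m = 0 ∧ n = 0) ∨ m < n := by
  unfold properExponents
  split_ifs with h
  · simp [h]
  · simp [h]

/-- The Möbius relation over a box. At `(0, 0)` the box would contain the point itself, with sum `1`
instead of `-1`. -/
lemma sum_properExponents_properDivMoebius (i j : ℕ) (hij : i ≠ 0 ∨ j ≠ 0) :
    ∑ k ∈ properExponents i, ∑ l ∈ properExponents j, properDivMoebius k l =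
      -properDivMoebius i j := by
  rcases i with _ | i <;> rcases j with _ | j
  · simp at hij
  · simpa [properExponents] using sum_range_properDivMoebius_right_zero j
  · simpa [properExponents] using sum_range_properDivMoebius_left_zero i
  · simpa [properExponents] using sum_range_sum_range_properDivMoebius i j

namespace ProperDivPoset

variable {n : ℕ} {a : Fin n → ℕ}

instance : Finite (ProperDivPoset a) := by
  have hle : ∀ (p : ProperDivPoset a) i, p.val i < a i + 1 := fun p i => by
    rcases p.le_top' with h | h
    · rw [h]; omega
    · have := h i
      omega
  exact Finite.of_injective
    (fun p i => ⟨p.val i, hle p i⟩ : ProperDivPoset a → ∀ i, Fin (a i + 1))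
    fun p q h => ProperDivPoset.ext (funext fun i => congrArg Fin.val (congrFun h i))

lemma val_bot : (⊥ : ProperDivPoset a).val = fun _ => 0 := rfl

lemma val_top : (⊤ : ProperDivPoset a).val = a := rfl

/-- The zero vector properly divides itself, so `⊥` has to be excluded. -/
lemma lt_iff {p q : ProperDivPoset a} (hq : q ≠ ⊥) : p < q ↔ ProperlyDivides p.val q.val := by
  refine ⟨fun h => h.le.resolve_left fun he => h.ne (ProperDivPoset.ext he), fun h => ?_⟩
  refine lt_of_le_of_ne (Or.inr h) fun he => hq (ProperDivPoset.ext (funext fun i => ?_))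
  have hi := h i
  rw [he] at hi
  show q.val i = 0
  omega

lemma exists_val_eq {q : ProperDivPoset a} {c : Fin n → ℕ} (h : ProperlyDivides c q.val) :
    ∃ p : ProperDivPoset a, p.val = c := by
  refine ⟨⟨c, Or.inr ?_⟩, rfl⟩
  rcases q.le_top' with h' | h'
  · exact h' ▸ h
  · intro i
    have h1 := h i
    have h2 := h' i
    omega

open Classical in
lemma sum_lt_eq_sum_properExponents {a : Fin 2 → ℕ} [Fintype (ProperDivPoset a)]
    {q : ProperDivPoset a} (hq : q ≠ ⊥) (f : ℕ → ℕ → ℤ) :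
    ∑ p : ProperDivPoset a with p < q, f (p.val 0) (p.val 1) =
      ∑ k ∈ properExponents (q.val 0), ∑ l ∈ properExponents (q.val 1), f k l := by
  rw [← Finset.sum_product']
  refine Finset.sum_bij (fun p _ => (p.val 0, p.val 1)) ?_ ?_ ?_ (fun _ _ => rfl)
  · intro p hp
    have h := (lt_iff hq).1 (Finset.mem_filter.1 hp).2
    exact Finset.mem_product.2 ⟨mem_properExponents.2 (h 0), mem_properExponents.2 (h 1)⟩
  · intro p _ p' _ h
    rw [Prod.mk.injEq] at h
    refine ProperDivPoset.ext (funext fun i => ?_)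
    fin_cases i
    exacts [h.1, h.2]
  · rintro ⟨k, l⟩ h
    rw [Finset.mem_product, mem_properExponents, mem_properExponents] at h
    have hd : ProperlyDivides ![k, l] q.val := by
      intro i
      fin_cases i
      exacts [h.1, h.2]
    obtain ⟨p, hp⟩ := exists_val_eq hd
    refine ⟨p, Finset.mem_filter.2 ⟨Finset.mem_univ _, (lt_iff hq).2 (hp ▸ hd)⟩, ?_⟩
    simp [hp]

lemma chainEulerChar_eq_properDivMoebius {a : Fin 2 → ℕ} (q : ProperDivPoset a) (hq : q ≠ ⊥) :
    chainEulerChar q = properDivMoebius (q.val 0) (q.val 1) := by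
  classical
  have := Fintype.ofFinite (ProperDivPoset a)
  induction q using WellFoundedLT.induction with
  | ind q ih =>
    have h1 : ∑ y : ProperDivPoset a with ⊥ < y ∧ y < q, chainEulerChar y =
        ∑ y : ProperDivPoset a with ⊥ < y ∧ y < q, properDivMoebius (y.val 0) (y.val 1) := by
      refine Finset.sum_congr rfl fun y hy => ?_
      obtain ⟨hy1, hy2⟩ := (Finset.mem_filter.1 hy).2
      exact ih y hy2 hy1.ne'
    have h2 : (Finset.univ.filter fun y : ProperDivPoset a => y < q) =
        -- Here `⊥` is split off: its term `μ = 1` accounts for the empty chain, whereas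
        -- `chainEulerChar ⊥` is `-1`.
        insert ⊥ (Finset.univ.filter fun y : ProperDivPoset a => ⊥ < y ∧ y < q) := by
      ext y
      by_cases hy : y = ⊥
      · simp [hy, bot_lt_iff_ne_bot, hq]
      · simp [hy, bot_lt_iff_ne_bot]
    have h3 := sum_lt_eq_sum_properExponents hq properDivMoebius
    rw [h2, Finset.sum_insert (by simp), sum_properExponents_properDivMoebius] at h3
    · rw [chainEulerChar_eq, h1]
      have h4 : properDivMoebius ((⊥ : ProperDivPoset a).val 0)
          ((⊥ : ProperDivPoset a).val 1) = 1 := by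
        rfl
      lia
    · by_contra! h
      refine hq (ProperDivPoset.ext (funext fun i => ?_))
      fin_cases i
      exacts [h.1, h.2]

lemma reducedEulerChar_add_two (m n : ℕ) :
    (orderComplex (ProperDivPoset ![m + 2, n + 2])).reducedEulerChar = 2 * diagCoeff m n := by
  rw [reducedEulerChar_orderComplex, chainEulerChar_eq_properDivMoebius]
  · simp [val_top, properDivMoebius]
  · intro h
    have := congrFun (congrArg ProperDivPoset.val h) 0
    simp [val_top, val_bot] at this

end ProperDivPoset

/-! ### The generating function -/

section GeneratingFunction

open MvPowerSeries

/-- The power series in two variables with given coefficients. -/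
def powerSeriesOfCoeff (f : ℕ → ℕ → ℚ) : MvPowerSeries (Fin 2) ℚ :=
  fun e => f (e 0) (e 1)

lemma coeff_powerSeriesOfCoeff (f : ℕ → ℕ → ℚ) (e : Fin 2 →₀ ℕ) :
    coeff e (powerSeriesOfCoeff f) = f (e 0) (e 1) := rfl

lemma coeff_X_mul_of_eq_add (s : Fin 2) (F : MvPowerSeries (Fin 2) ℚ) (e d : Fin 2 →₀ ℕ)
    (h : e = Finsupp.single s 1 + d) : coeff e (X s * F) = coeff d F := by
  rw [h, X, coeff_add_monomial_mul, one_mul]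

lemma coeff_X_mul_of_eq_zero (s : Fin 2) (F : MvPowerSeries (Fin 2) ℚ) (e : Fin 2 →₀ ℕ)
    (h : e s = 0) : coeff e (X s * F) = 0 := by
  classical
  rw [X, coeff_monomial_mul, if_neg]
  intro h'
  have := h' s
  simp [h] at this

/-- Multiplying by the denominator encodes the recursion at interior exponents; on the axes the
constant value `1` cancels, leaving only the constant term. -/
lemma inv_eq_powerSeriesOfCoeff :
    (2 * X 0 * X 1 - X 0 - X 1 + 1 : MvPowerSeries (Fin 2) ℚ)⁻¹ =
      powerSeriesOfCoeff fun m n => (diagCoeff m n : ℚ) := by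
  symm
  rw [MvPowerSeries.eq_inv_iff_mul_eq_one (by simp)]
  set F := powerSeriesOfCoeff fun m n => (diagCoeff m n : ℚ) with hF
  -- With `2uvF` written as a sum of two copies, each coefficient is found by shifting one variable
  -- at a time.
  have hexp : F * (2 * X 0 * X 1 - X 0 - X 1 + 1) =
      X 0 * (X 1 * F) + X 0 * (X 1 * F) - X 0 * F - X 1 * F + F := by ring
  rw [hexp]
  ext e
  obtain ⟨m, n, rfl⟩ : ∃ m n, e = Finsupp.single 0 m + Finsupp.single 1 n :=
    ⟨e 0, e 1, by ext i; fin_cases i <;> simp⟩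
  rw [map_add, map_sub, map_sub, map_add]
  rcases m with _ | m <;> rcases n with _ | n
  · simp [coeff_X_mul_of_eq_zero, hF, coeff_powerSeriesOfCoeff, diagCoeff_zero_left]
  · rw [coeff_X_mul_of_eq_zero 0 _ _ (by simp), coeff_X_mul_of_eq_zero 0 _ _ (by simp),
      coeff_X_mul_of_eq_add 1 F _ (Finsupp.single 1 n)
        (by rw [Finsupp.single_zero, zero_add, ← Finsupp.single_add, add_comm])]
    simp [hF, coeff_powerSeriesOfCoeff, diagCoeff_zero_left, coeff_one]
  · rw [coeff_X_mul_of_eq_add 0 _ _ (Finsupp.single 0 m)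
        (by rw [Finsupp.single_zero, add_zero, ← Finsupp.single_add, add_comm]),
      coeff_X_mul_of_eq_add 0 _ _ (Finsupp.single 0 m)
        (by rw [Finsupp.single_zero, add_zero, ← Finsupp.single_add, add_comm]),
      coeff_X_mul_of_eq_zero 1 _ _ (by simp), coeff_X_mul_of_eq_zero 1 _ _ (by simp)]
    simp [hF, coeff_powerSeriesOfCoeff, diagCoeff_zero_right, coeff_one]
  · rw [coeff_X_mul_of_eq_add 0 _ _ (Finsupp.single 0 m + Finsupp.single 1 (n + 1))
        (by rw [← add_assoc, ← Finsupp.single_add, add_comm m]),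
      coeff_X_mul_of_eq_add 0 _ _ (Finsupp.single 0 m + Finsupp.single 1 (n + 1))
        (by rw [← add_assoc, ← Finsupp.single_add, add_comm m]),
      coeff_X_mul_of_eq_add 1 _ _ (Finsupp.single 0 m + Finsupp.single 1 n)
        (by rw [add_left_comm, ← Finsupp.single_add, add_comm n]),
      coeff_X_mul_of_eq_add 1 _ _ (Finsupp.single 0 (m + 1) + Finsupp.single 1 n)
        (by rw [add_left_comm, ← Finsupp.single_add, add_comm n])]
    have hne : Finsupp.single (0 : Fin 2) (m + 1) + Finsupp.single 1 (n + 1) ≠ 0 := fun h => by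
      simpa using DFunLike.congr_fun h 0
    rw [coeff_one, if_neg hne]
    simp [hF, coeff_powerSeriesOfCoeff, diagCoeff_succ_succ]
    ring

lemma coeff_two_mul_X_sq_mul_inv (m n : ℕ) :
    coeff (Finsupp.single (0 : Fin 2) (m + 2) + Finsupp.single 1 (n + 2))
      (2 * X 0 ^ 2 * X 1 ^ 2 * (2 * X 0 * X 1 - X 0 - X 1 + 1)⁻¹ : MvPowerSeries (Fin 2) ℚ) =
    2 * (diagCoeff m n : ℚ) := by
  rw [inv_eq_powerSeriesOfCoeff]
  set F := powerSeriesOfCoeff fun m n => (diagCoeff m n : ℚ) with hF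
  have hexp : 2 * X 0 ^ 2 * X 1 ^ 2 * F =
      monomial (Finsupp.single 0 2 + Finsupp.single 1 2) 2 * F := by
    rw [X_pow_eq, X_pow_eq, mul_assoc 2, monomial_mul_monomial, one_mul, two_mul, ← map_add]
    norm_num
  have hidx : Finsupp.single (0 : Fin 2) (m + 2) + Finsupp.single 1 (n + 2) =
      (Finsupp.single 0 2 + Finsupp.single 1 2) + (Finsupp.single 0 m + Finsupp.single 1 n) := by
    rw [Finsupp.single_add, Finsupp.single_add]
    abel
  rw [hexp, hidx, coeff_add_monomial_mul, hF, coeff_powerSeriesOfCoeff]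
  simp

end GeneratingFunction

theorem theorem1p5 (a b : ℕ) (ha : 2 ≤ a) (hab : a ≤ b) :
    (orderComplex (ProperDivPoset ![a, b])).reducedEulerChar =
      (-1 : ℤ) ^ a * (2 * ∑ h ∈ Finset.range (a / 2),
        (-1 : ℤ) ^ h * ((a - 2).choose h : ℤ) * ((b - a).choose (a - 2 - 2 * h) : ℤ)) ∧
    (((orderComplex (ProperDivPoset ![a, b])).reducedEulerChar : ℤ) : ℚ) =
      MvPowerSeries.coeff (Finsupp.single (0 : Fin 2) a + Finsupp.single (1 : Fin 2) b)
        ((2 * MvPowerSeries.X 0 ^ 2 * MvPowerSeries.X 1 ^ 2 *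
          (2 * MvPowerSeries.X 0 * MvPowerSeries.X 1 - MvPowerSeries.X 0 - MvPowerSeries.X 1
            + 1)⁻¹ : MvPowerSeries (Fin 2) ℚ)) := by
  -- Setting `a = m + 2`, `b = m + r + 2` removes the truncated subtractions in `a - 2` and `b - a`.
  obtain ⟨m, rfl⟩ : ∃ m, a = m + 2 := ⟨a - 2, by omega⟩
  obtain ⟨r, rfl⟩ : ∃ r, b = m + r + 2 := ⟨b - (m + 2), by omega⟩
  rw [ProperDivPoset.reducedEulerChar_add_two]
  constructor
  · rw [diagCoeff_add, show (m + 2) / 2 = m / 2 + 1 by omega, show m + 2 - 2 = m by omega,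
      show m + r + 2 - (m + 2) = r by omega]
    ring
  · rw [coeff_two_mul_X_sq_mul_inv]
    push_cast
    rfl
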